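/- Let $\mathfrak{R}=\mathbb{Z}_4+v\mathbb{Z}_4=\mathbb{Z}_4[v]/\langle v^2-v\rangle$. A cyclic code of length $n$ over $\mathfrak{R}$ is an $\mathfrak{R}$-submodule $C\subseteq\mathfrak{R}^n$ such that $(c_{n-1},c_0,\dots,c_{n-2})\in C$ whenever $(c_0,c_1,\dots,c_{n-1})\in C$. Its dual is $C^{\perp}=\{h\in\mathfrak{R}^n : \sum_{i=0}^{n-1}h_ik_i=0 \text{ for all } k\in C\}$, its hull is $\mathrm{Hull}(C)=C\cap C^{\perp}$, and the $2$-dimension of a code $D\subseteq\mathfrak{R}^n$ is $\dim_2(D)=\log_2|D|$. Let $\mathcal{C}_n$ be the finite set of all cyclic codes of length $n$ over $\mathfrak{R}$, and let $$E(n)=\frac{1}{|\mathcal{C}_n|}\sum_{C\in\mathcal{C}_n}\dim_2(\mathrm{Hull}(C))$$ be the average $2$-dimension of their hulls. Then for every odd positive integer $n$, $$E(n)<\frac{10n}{9}.$$ -/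

import Mathlib

namespace CyclicHull

/-- The ring `ℤ₄ + vℤ₄ = ℤ₄[v] / ⟨v² - v⟩`. -/
abbrev Z4v : Type := AdjoinRoot (Polynomial.X ^ 2 - Polynomial.X : Polynomial (ZMod 4))

instance finite_Z4v : Finite Z4v := by
  have hm : (Polynomial.X ^ 2 - Polynomial.X : Polynomial (ZMod 4)).Monic := by
    monicity!
  have : Module.Finite (ZMod 4) Z4v := hm.finite_adjoinRoot
  exact Module.finite_of_finite (ZMod 4)

/-- A linear code `C` of length `n` over `A` (a submodule of `Aⁿ`) is cyclic if it contains with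
each word `(c₀, c₁, …, cₙ₋₁)` its cyclic shift `(cₙ₋₁, c₀, …, cₙ₋₂)`. -/
def IsCyclicCode {A : Type} [CommRing A] {n : ℕ} (C : Submodule A (Fin n → A)) : Prop :=
  ∀ c ∈ C, (fun i => c ((finRotate n).symm i)) ∈ C

/-- The dual code with respect to the inner product `h · k = h₀k₀ + ⋯ + hₙ₋₁kₙ₋₁`. -/
def dualCode {A : Type} [CommRing A] {n : ℕ} (C : Submodule A (Fin n → A)) :
    Submodule A (Fin n → A) where
  carrier := {h | ∀ k ∈ C, ∑ i, h i * k i = 0}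
  zero_mem' := by
    intro k _
    simp
  add_mem' := by
    intro a b ha hb k hk
    simp [add_mul, Finset.sum_add_distrib, ha k hk, hb k hk]
  smul_mem' := by
    intro r a ha k hk
    simp [mul_assoc, ← Finset.mul_sum, ha k hk]

/-- The hull of a code is its intersection with its dual. -/
def hull {A : Type} [CommRing A] {n : ℕ} (C : Submodule A (Fin n → A)) :
    Submodule A (Fin n → A) :=
  C ⊓ dualCode C

/-- The 2-dimension of a finite code: the base-2 logarithm of its number of words. -/
noncomputable def twoDim {A : Type} [CommRing A] {n : ℕ} (C : Submodule A (Fin n → A)) : ℝ :=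
  Real.logb 2 (Nat.card C)

/-- The cyclic codes of length `n` over `ℤ₄ + vℤ₄`. -/
def CyclicCode (n : ℕ) : Type :=
  {C : Submodule Z4v (Fin n → Z4v) // IsCyclicCode C}

instance finite_cyclicCode (n : ℕ) : Finite (CyclicCode n) :=
  inferInstanceAs (Finite {C : Submodule Z4v (Fin n → Z4v) // IsCyclicCode C})

noncomputable instance fintype_cyclicCode (n : ℕ) : Fintype (CyclicCode n) :=
  Fintype.ofFinite _

/-- `E(n)`: the average 2-dimension of the hulls of all cyclic codes of length `n`
over `ℤ₄ + vℤ₄`. -/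
noncomputable def averageHullDim (n : ℕ) : ℝ :=
  (∑ C : CyclicCode n, twoDim (hull C.1)) / (Fintype.card (CyclicCode n) : ℝ)

end CyclicHull

/-!
Cyclic codes of length `n` over `A` are the ideals of the group algebra `S = A[x] / (xⁿ - 1)`, and
the dual of an ideal `I` is the image of its annihilator under the involution `σ : x ↦ x⁻¹`. Over
`A = ℤ₄ + vℤ₄` with `n` odd, the localizations of `S` are chain rings of length two with uniformizer
`2`: as `n` is a unit, the coefficients of a nilpotent element are, up to units, traces of
nilpotent elements, so they are nilpotent and hence divisible by `2`. Ideals of `S` therefore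
correspond to arbitrary functions `a : Spec S → {0, 1, 2}` of local exponents, and the hull of `I`
has local length `2 - max (a p) (2 - a (σ p))` at `p`.

For `a` uniform, this length has mean `5/9` if `σ p ≠ p` and only `1/3` if `σ p = p`, which happens
for some `p` above the augmentation ideal. Weighting the primes by `log |S / p|`, whose sum is
`(log |S|) / 2`, gives `E(n) < (5/9) (log₂ |S|) / 2 = 10 n / 9`.
-/

namespace CyclicHull

open scoped BigOperators

section Expectation

variable {ι α : Type*} [Fintype ι] [DecidableEq ι] [Fintype α] [Nonempty α]

lemma expect_eval (f : α → ℝ) (i : ι) : 𝔼 t : ι → α, f (t i) = 𝔼 a, f a := by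
  have h := Fintype.sum_piFinset_apply f Finset.univ i
  rw [Fintype.piFinset_univ, Finset.card_univ, nsmul_eq_mul, Nat.cast_pow] at h
  have hα : (Fintype.card α : ℝ) ≠ 0 := Nat.cast_ne_zero.2 Fintype.card_ne_zero
  rw [Fintype.expect_eq_sum_div_card, Fintype.expect_eq_sum_div_card, h, Fintype.card_fun,
    Nat.cast_pow, ← mul_pow_sub_one (Fintype.card_pos_iff.2 ⟨i⟩).ne', mul_comm (Fintype.card α : ℝ)]
  exact mul_div_mul_left _ _ (pow_ne_zero _ hα)

lemma expect_eval_eval (f : α → α → ℝ) {i j : ι} (hij : i ≠ j) :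
    𝔼 t : ι → α, f (t i) (t j) = 𝔼 a, 𝔼 b, f a b := by
  let F (s : α × ({k // k ≠ i} → α)) : ℝ := f s.1 (s.2 ⟨j, hij.symm⟩)
  calc 𝔼 t : ι → α, f (t i) (t j)
    _ = 𝔼 s : α × ({k // k ≠ i} → α), F s :=
        Fintype.expect_equiv (Equiv.funSplitAt i α) _ _ fun t => by
          simp only [F, Equiv.funSplitAt_apply]
    _ = 𝔼 a, 𝔼 s : {k // k ≠ i} → α, F (a, s) := by
        rw [← Finset.univ_product_univ, Finset.expect_product]
    _ = 𝔼 a, 𝔼 b, f a b :=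
        Finset.expect_congr rfl fun a _ => expect_eval (f a) _

end Expectation

section LogNorm

variable {S : Type*} [CommRing S]

/-- The logarithm of the absolute norm `|S ⧸ I|` of an ideal. -/
noncomputable def logNorm (I : Ideal S) : ℝ :=
  Real.log (Nat.card (S ⧸ I))

instance finite_quotient [Finite S] (I : Ideal S) : Finite (S ⧸ I) :=
  Finite.of_surjective _ Ideal.Quotient.mk_surjective

lemma logNorm_pos [Finite S] {I : Ideal S} (hI : I ≠ ⊤) : 0 < logNorm I := by
  have := Ideal.Quotient.nontrivial_iff.2 hI
  exact Real.log_pos (Nat.one_lt_cast.2 Finite.one_lt_card)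

lemma logNorm_bot : logNorm (⊥ : Ideal S) = Real.log (Nat.card S) := by
  rw [logNorm, Nat.card_congr (RingEquiv.quotientBot S).toEquiv]

lemma log_card_add_logNorm [Finite S] (I : Ideal S) :
    Real.log (Nat.card I) + logNorm I = Real.log (Nat.card S) := by
  rw [logNorm, ← Real.log_mul (Nat.cast_ne_zero.2 Nat.card_pos.ne')
    (Nat.cast_ne_zero.2 Nat.card_pos.ne'), ← Nat.cast_mul,
    ← Submodule.card_eq_card_quotient_mul_card]

/-- Multiplication by `π` and reduction form an exact sequence
`0 → S ⧸ (I : π) → S ⧸ I → S ⧸ (I + (π)) → 0`. -/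
lemma logNorm_eq_logNorm_sup_add_logNorm_colon [Finite S] (I : Ideal S) (π : S) :
    logNorm I = logNorm (I ⊔ Ideal.span {π}) + logNorm (I.colon {π}) := by
  let φ : S →ₗ[S] S ⧸ I := LinearMap.toSpanSingleton S (S ⧸ I) (I.mkQ π)
  have hker : LinearMap.ker φ = I.colon {π} := by
    ext x
    rw [LinearMap.mem_ker, LinearMap.toSpanSingleton_apply, ← map_smul,
      Submodule.mkQ_apply, Submodule.Quotient.mk_eq_zero, Submodule.mem_colon_singleton]
  have hrange : LinearMap.range φ = Submodule.map I.mkQ (Ideal.span {π}) := by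
    rw [LinearMap.range_toSpanSingleton, Ideal.span, Submodule.map_span, Set.image_singleton]
  have hcard : Nat.card (S ⧸ I) = Nat.card (S ⧸ I ⊔ Ideal.span {π}) * Nat.card (S ⧸ I.colon {π}) :=
    calc Nat.card (S ⧸ I)
      _ = Nat.card ((S ⧸ I) ⧸ LinearMap.range φ) * Nat.card (LinearMap.range φ) := by
          rw [Submodule.card_eq_card_quotient_mul_card (LinearMap.range φ), mul_comm]
      _ = Nat.card (S ⧸ I ⊔ Ideal.span {π}) * Nat.card (S ⧸ I.colon {π}) := by
          rw [← Nat.card_congr φ.quotKerEquivRange.toEquiv, hker, hrange,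
            Nat.card_congr (Submodule.quotientQuotientEquivQuotientSup I _).toEquiv]
  rw [logNorm, hcard, Nat.cast_mul, Real.log_mul (Nat.cast_ne_zero.2 Nat.card_pos.ne')
    (Nat.cast_ne_zero.2 Nat.card_pos.ne'), logNorm, logNorm]

open Classical in
lemma logNorm_eq_sum_of_isRadical [Finite S] [Fintype (PrimeSpectrum S)] {J : Ideal S}
    (hJ : J.IsRadical) :
    logNorm J = ∑ p : PrimeSpectrum S, if J ≤ p.asIdeal then logNorm p.asIdeal else 0 := by
  let P (p : {p : PrimeSpectrum S // J ≤ p.asIdeal}) : Ideal S := p.1.asIdeal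
  have hinf : ⨅ p, P p = J := le_antisymm
    (calc ⨅ p, P p
      _ ≤ sInf {q | J ≤ q ∧ q.IsPrime} := le_sInf fun q hq => iInf_le P ⟨⟨q, hq.2⟩, hq.1⟩
      _ = J := by rw [← Ideal.radical_eq_sInf, hJ.radical])
    (le_iInf fun p => p.2)
  have hcoprime : Pairwise (Function.onFun IsCoprime P) := fun p q hpq => by
    have hp := Ideal.isMaximal_of_isPrime p.1.asIdeal
    have hq := Ideal.isMaximal_of_isPrime q.1.asIdeal
    exact Ideal.isCoprime_iff_sup_eq.2 <| hp.coprime_of_ne hq fun h =>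
      hpq (Subtype.ext (PrimeSpectrum.ext h))
  have hcard := Nat.card_congr (Ideal.quotientInfRingEquivPiQuotient P hcoprime).toEquiv
  rw [hinf, Nat.card_pi] at hcard
  rw [logNorm, hcard, Nat.cast_prod, Real.log_prod fun p _ => Nat.cast_ne_zero.2 Nat.card_pos.ne',
    ← Finset.sum_filter, ← Finset.sum_subtype_eq_sum_filter, Finset.subtype_univ]
  rfl

lemma exists_isNilpotent_mul_one_sub_pow [Finite S] (x : S) :
    ∃ k ≠ 0, IsNilpotent (x * (1 - x ^ k)) := by
  obtain ⟨i, j, hij, h⟩ : ∃ i j : ℕ, i < j ∧ x ^ i = x ^ j := by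
    obtain ⟨i, j, hne, h⟩ := Finite.exists_ne_map_eq_of_infinite fun i : ℕ => x ^ i
    rcases hne.lt_or_gt with hlt | hlt
    exacts [⟨i, j, hlt, h⟩, ⟨j, i, hlt, h.symm⟩]
  refine ⟨j - i, (Nat.sub_pos_of_lt hij).ne', i + 1, ?_⟩
  have hx : x ^ i * (1 - x ^ (j - i)) = 0 := by
    rw [mul_sub, mul_one, pow_mul_pow_sub x hij.le, h, sub_self]
  rw [mul_pow]
  linear_combination x * (1 - x ^ (j - i)) ^ i * hx

end LogNorm

/-- `π` generates both the nilradical and its own annihilator. For finite `S` this means that `S` is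
a finite product of chain rings of length two with uniformizer `π`, such as Galois rings of
characteristic `p ^ 2` with `π = p`. -/
structure IsSquareZeroUniformizer {S : Type*} [CommRing S] (π : S) : Prop where
  mul_eq_zero_iff : ∀ x, π * x = 0 ↔ π ∣ x
  dvd_of_isNilpotent : ∀ x, IsNilpotent x → π ∣ x

namespace IsSquareZeroUniformizer

variable {S : Type*} [CommRing S] {π : S} (hπ : IsSquareZeroUniformizer π)
include hπ

lemma self_mul_self_mul (x : S) : π * (π * x) = 0 :=
  (hπ.mul_eq_zero_iff _).2 (dvd_mul_right π x)

lemma mem_asIdeal (p : PrimeSpectrum S) : π ∈ p.asIdeal := by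
  have h : π * π = 0 := (hπ.mul_eq_zero_iff π).2 dvd_rfl
  exact or_self_iff.1 (p.isPrime.mem_or_mem (h ▸ p.asIdeal.zero_mem : π * π ∈ p.asIdeal))

lemma isRadical_of_mem [Finite S] {J : Ideal S} (hJ : π ∈ J) : J.IsRadical := by
  refine (Ideal.isRadical_iff_pow_one_lt 2 one_lt_two).2 fun x hx => ?_
  obtain ⟨k, hk, hnil⟩ := exists_isNilpotent_mul_one_sub_pow x
  have hpow : x ^ (k + 1) ∈ J := J.pow_mem_of_pow_mem hx (by lia)
  have hsub : x * (1 - x ^ k) ∈ J := J.mem_of_dvd (hπ.dvd_of_isNilpotent _ hnil) hJ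
  rw [show x = x * (1 - x ^ k) + x ^ (k + 1) by ring]
  exact add_mem hsub hpow

lemma mem_of_dvd_mul {p : PrimeSpectrum S} {x y : S} (h : π ∣ x * y) (hx : x ∉ p.asIdeal) :
    y ∈ p.asIdeal :=
  (p.isPrime.mem_or_mem (p.asIdeal.mem_of_dvd h (hπ.mem_asIdeal p))).resolve_left hx

/-- The localization of `S` at `p` has maximal ideal `(π)`. -/
lemma exists_notMem_forall_dvd_mul [Finite S] (p : PrimeSpectrum S) :
    ∃ e ∉ p.asIdeal, ∀ x ∈ p.asIdeal, π ∣ e * x := by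
  have hloc (x : p.asIdeal) : ∃ e ∉ p.asIdeal, π ∣ e * x := by
    obtain ⟨k, hk, hnil⟩ := exists_isNilpotent_mul_one_sub_pow (x : S)
    refine ⟨1 - (x : S) ^ k, fun hmem => p.isPrime.one_notMem ?_, ?_⟩
    · simpa using add_mem hmem (p.asIdeal.pow_mem_of_mem x.2 k (Nat.pos_of_ne_zero hk))
    · rw [mul_comm]
      exact hπ.dvd_of_isNilpotent _ hnil
  choose e he hdvd using hloc
  have := Fintype.ofFinite p.asIdeal
  refine ⟨∏ x, e x, fun hmem => ?_, fun x hx => (hdvd ⟨x, hx⟩).trans ?_⟩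
  · obtain ⟨x, -, hx⟩ := p.isPrime.prod_mem_iff.1 hmem
    exact he x hx
  · exact mul_dvd_mul_right (Finset.dvd_prod_of_mem e (Finset.mem_univ _)) x

lemma not_annihilator_le_iff [Finite S] (I : Ideal S) (p : PrimeSpectrum S) :
    ¬ I.annihilator ≤ p.asIdeal ↔ I.colon {π} ≤ p.asIdeal := by
  constructor
  · intro h x hx
    obtain ⟨a, ha, hap⟩ := SetLike.not_le_iff_exists.1 h
    have hzero : π * (a * x) = 0 := by
      rw [← Submodule.mem_annihilator.1 ha _ (Submodule.mem_colon_singleton.1 hx), smul_eq_mul,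
        smul_eq_mul]
      ring
    exact hπ.mem_of_dvd_mul ((hπ.mul_eq_zero_iff _).1 hzero) hap
  · intro h hle
    obtain ⟨e, he, hdvd⟩ := hπ.exists_notMem_forall_dvd_mul p
    suffices hmem : e * e ∈ I.annihilator from
      he (or_self_iff.1 (p.isPrime.mem_or_mem (hle hmem)))
    refine Submodule.mem_annihilator.2 fun x hx => ?_
    obtain ⟨y, hy⟩ := hdvd x (h (Ideal.le_colon hx))
    have hyI : y ∈ I.colon {π} := by
      rw [Submodule.mem_colon_singleton, smul_eq_mul, mul_comm, ← hy]
      exact I.mul_mem_left e hx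
    obtain ⟨z, hz⟩ := hdvd y (h hyI)
    calc e * e * x = π * (e * y) := by linear_combination e * hy
      _ = 0 := by rw [hz, hπ.self_mul_self_mul]

lemma not_colon_annihilator_le_iff [Finite S] (I : Ideal S) (p : PrimeSpectrum S) :
    ¬ I.annihilator.colon {π} ≤ p.asIdeal ↔ I ≤ p.asIdeal := by
  constructor
  · intro h x hx
    obtain ⟨a, ha, hap⟩ := SetLike.not_le_iff_exists.1 h
    have hzero : π * (a * x) = 0 := by
      rw [← Submodule.mem_annihilator.1 (Submodule.mem_colon_singleton.1 ha) _ hx, smul_eq_mul,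
        smul_eq_mul]
      ring
    exact hπ.mem_of_dvd_mul ((hπ.mul_eq_zero_iff _).1 hzero) hap
  · intro h hle
    obtain ⟨e, he, hdvd⟩ := hπ.exists_notMem_forall_dvd_mul p
    refine he (hle ?_)
    refine Submodule.mem_colon_singleton.2 (Submodule.mem_annihilator.2 fun x hx => ?_)
    obtain ⟨y, hy⟩ := hdvd x (h hx)
    calc e * π * x = π * (e * x) := by ring
      _ = 0 := by rw [hy, hπ.self_mul_self_mul]

end IsSquareZeroUniformizer

section LocalExponent

variable {S : Type*} [CommRing S] {π : S}

open Classical in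
/-- The exponent `a ≤ 2` for which the ideal `I` is locally `(π ^ a)` at the prime `p`, when `π` is
a square-zero uniformizer: `I` vanishes at `p` iff `(I : π)` is contained in `p`. -/
noncomputable def localExponent (π : S) (I : Ideal S) (p : PrimeSpectrum S) : Fin 3 :=
  if I.colon {π} ≤ p.asIdeal then 2 else if I ≤ p.asIdeal then 1 else 0

lemma localExponent_eq_two_iff {I : Ideal S} {p : PrimeSpectrum S} :
    localExponent π I p = 2 ↔ I.colon {π} ≤ p.asIdeal := by
  unfold localExponent
  split_ifs <;> simp_all

lemma localExponent_eq_zero_iff {I : Ideal S} {p : PrimeSpectrum S} :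
    localExponent π I p = 0 ↔ ¬ I ≤ p.asIdeal := by
  have hle : I.colon {π} ≤ p.asIdeal → I ≤ p.asIdeal := Ideal.le_colon.trans
  unfold localExponent
  split_ifs <;> simp_all

lemma fin_three_eq_of_iff {a b : Fin 3} (h₀ : a = 0 ↔ b = 0) (h₂ : a = 2 ↔ b = 2) : a = b := by
  lia

lemma localExponent_top (p : PrimeSpectrum S) : localExponent π ⊤ p = 0 :=
  localExponent_eq_zero_iff.2 fun h => p.isPrime.ne_top (top_le_iff.1 h)

lemma localExponent_inf (I J : Ideal S) (p : PrimeSpectrum S) :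
    localExponent π (I ⊓ J) p = max (localExponent π I p) (localExponent π J p) := by
  apply fin_three_eq_of_iff
  · have h : ∀ a b : Fin 3, max a b = 0 ↔ a = 0 ∧ b = 0 := by decide
    rw [h, localExponent_eq_zero_iff, localExponent_eq_zero_iff, localExponent_eq_zero_iff,
      p.isPrime.inf_le, not_or]
  · have h : ∀ a b : Fin 3, max a b = 2 ↔ a = 2 ∨ b = 2 := by decide
    rw [h, localExponent_eq_two_iff, localExponent_eq_two_iff, localExponent_eq_two_iff,
      Submodule.inf_colon, p.isPrime.inf_le]

lemma localExponent_finset_inf {ι : Type*} (s : Finset ι) (I : ι → Ideal S) (p : PrimeSpectrum S) :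
    localExponent π (s.inf I) p = s.sup fun i => localExponent π (I i) p := by
  classical
  induction s using Finset.induction_on with
  | empty => exact localExponent_top p
  | insert i s _ ih => rw [Finset.inf_insert, Finset.sup_insert, localExponent_inf, ih]

lemma comap_le_iff_le_comap_symm (σ : S ≃+* S) (J : Ideal S) (p : PrimeSpectrum S) :
    J.comap σ ≤ p.asIdeal ↔ J ≤ (PrimeSpectrum.comap (σ.symm : S →+* S) p).asIdeal := by
  rw [← Ideal.map_symm]
  exact Ideal.map_le_iff_le_comap

lemma localExponent_comap (σ : S ≃+* S) (hσ : σ π = π) (J : Ideal S) (p : PrimeSpectrum S) :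
    localExponent π (J.comap σ) p =
      localExponent π J (PrimeSpectrum.comap (σ.symm : S →+* S) p) := by
  have hcolon : (J.comap σ).colon {π} = (J.colon {π}).comap σ := by
    ext x
    rw [Submodule.mem_colon_singleton, Ideal.mem_comap, Ideal.mem_comap,
      Submodule.mem_colon_singleton, smul_eq_mul, map_mul, hσ, smul_eq_mul]
  unfold localExponent
  rw [hcolon, comap_le_iff_le_comap_symm, comap_le_iff_le_comap_symm]

namespace IsSquareZeroUniformizer

variable [Finite S] (hπ : IsSquareZeroUniformizer π)
include hπ

lemma localExponent_annihilator (I : Ideal S) (p : PrimeSpectrum S) :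
    localExponent π I.annihilator p = (localExponent π I p).rev := by
  apply fin_three_eq_of_iff
  · have h : ∀ a : Fin 3, a.rev = 0 ↔ a = 2 := by decide
    rw [h, localExponent_eq_zero_iff, localExponent_eq_two_iff, hπ.not_annihilator_le_iff]
  · have h : ∀ a : Fin 3, a.rev = 2 ↔ a = 0 := by decide
    rw [h, localExponent_eq_two_iff, localExponent_eq_zero_iff,
      ← hπ.not_colon_annihilator_le_iff I p, not_not]

lemma logNorm_eq_sum [Fintype (PrimeSpectrum S)] (I : Ideal S) :
    logNorm I = ∑ p : PrimeSpectrum S, (localExponent π I p : ℝ) * logNorm p.asIdeal := by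
  classical
  have hcolon : π ∈ I.colon {π} := by
    rw [Submodule.mem_colon_singleton, smul_eq_mul, (hπ.mul_eq_zero_iff π).2 dvd_rfl]
    exact I.zero_mem
  have hsup : π ∈ I ⊔ Ideal.span {π} :=
    Ideal.mem_sup_right (Ideal.mem_span_singleton_self π)
  rw [logNorm_eq_logNorm_sup_add_logNorm_colon I π,
    logNorm_eq_sum_of_isRadical (hπ.isRadical_of_mem hsup),
    logNorm_eq_sum_of_isRadical (hπ.isRadical_of_mem hcolon), ← Finset.sum_add_distrib]
  refine Finset.sum_congr rfl fun p _ => ?_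
  have hspan : I ⊔ Ideal.span {π} ≤ p.asIdeal ↔ I ≤ p.asIdeal := by
    rw [sup_le_iff, Ideal.span_singleton_le_iff_mem, and_iff_left (hπ.mem_asIdeal p)]
  have hle : I.colon {π} ≤ p.asIdeal → I ≤ p.asIdeal := Ideal.le_colon.trans
  rw [hspan]
  unfold localExponent
  split_ifs <;> simp_all [two_mul]

lemma log_card_eq_two_mul_sum [Fintype (PrimeSpectrum S)] :
    Real.log (Nat.card S) = 2 * ∑ p : PrimeSpectrum S, logNorm p.asIdeal := by
  have hbot (p : PrimeSpectrum S) : localExponent π ⊥ p = 2 :=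
    localExponent_eq_two_iff.2 fun x hx => by
      rw [Submodule.mem_colon_singleton, smul_eq_mul, mul_comm, Submodule.mem_bot,
        hπ.mul_eq_zero_iff] at hx
      exact p.asIdeal.mem_of_dvd hx (hπ.mem_asIdeal p)
  rw [← logNorm_bot, hπ.logNorm_eq_sum, Finset.mul_sum]
  exact Finset.sum_congr rfl fun p _ => by rw [hbot]; norm_num

lemma log_card_ideal [Fintype (PrimeSpectrum S)] (I : Ideal S) :
    Real.log (Nat.card I) =
      ∑ p : PrimeSpectrum S, ((localExponent π I p).rev : ℝ) * logNorm p.asIdeal := by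
  have hrev (a : Fin 3) : (a.rev : ℝ) = 2 - a := by fin_cases a <;> norm_num [Fin.rev]
  rw [eq_sub_of_add_eq (log_card_add_logNorm I), hπ.log_card_eq_two_mul_sum,
    hπ.logNorm_eq_sum, Finset.mul_sum, ← Finset.sum_sub_distrib]
  exact Finset.sum_congr rfl fun p _ => by rw [hrev, sub_mul]

lemma localExponent_injective : Function.Injective (localExponent π) := by
  intro I K h
  have := Fintype.ofFinite (PrimeSpectrum S)
  have heq {J : Ideal S} (hle : I ⊓ K ≤ J) (hJ : localExponent π (I ⊓ K) = localExponent π J) :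
      I ⊓ K = J := by
    have hlog : Real.log (Nat.card J) = Real.log (Nat.card (I ⊓ K : Ideal S)) := by
      rw [hπ.log_card_ideal, hπ.log_card_ideal, hJ]
    have hcard : Nat.card J = Nat.card (I ⊓ K : Ideal S) := Nat.cast_injective <|
      Real.log_injOn_pos (Set.mem_Ioi.2 (Nat.cast_pos.2 Nat.card_pos))
        (Set.mem_Ioi.2 (Nat.cast_pos.2 Nat.card_pos)) hlog
    exact SetLike.coe_injective (Set.eq_of_subset_of_ncard_le hle hcard.le (Set.toFinite _))
  have hinf : localExponent π (I ⊓ K) = localExponent π I :=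
    funext fun p => by rw [localExponent_inf, ← h, max_self]
  exact (heq inf_le_left hinf).symm.trans (heq inf_le_right (hinf.trans h))

lemma colon_sq_le (p : PrimeSpectrum S) : (p.asIdeal ^ 2).colon {π} ≤ p.asIdeal := by
  obtain ⟨e, he, hdvd⟩ := hπ.exists_notMem_forall_dvd_mul p
  have hann : p.asIdeal ^ 2 ≤ (Ideal.span {e * e}).annihilator := by
    rw [sq, Ideal.mul_le]
    intro x hx y hy
    obtain ⟨a, ha⟩ := hdvd x hx
    obtain ⟨b, hb⟩ := hdvd y hy
    rw [Ideal.span, Submodule.mem_annihilator_span_singleton, smul_eq_mul, mul_comm,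
      mul_mul_mul_comm, ha, hb, mul_assoc, mul_left_comm, hπ.self_mul_self_mul, mul_zero]
  intro x hx
  have hzero : π * (e * e * x) = 0 := by
    have := (Submodule.mem_annihilator_span_singleton _ _).1
      (hann (Submodule.mem_colon_singleton.1 hx))
    rw [← this, smul_eq_mul, smul_eq_mul]
    ring
  refine hπ.mem_of_dvd_mul ((hπ.mul_eq_zero_iff _).1 hzero) fun h => ?_
  exact he (or_self_iff.1 (p.isPrime.mem_or_mem h))

lemma localExponent_pow_self (p : PrimeSpectrum S) (a : Fin 3) :
    localExponent π (p.asIdeal ^ (a : ℕ)) p = a := by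
  fin_cases a
  · simpa using localExponent_top p
  · have hcolon : p.asIdeal.colon {π} = ⊤ := Ideal.eq_top_iff_one _ |>.2 <| by
      simpa [Submodule.mem_colon_singleton] using hπ.mem_asIdeal p
    have htop : ¬ (⊤ : Ideal S) ≤ p.asIdeal := fun h => p.isPrime.ne_top (top_le_iff.1 h)
    simp [localExponent, hcolon, htop]
  · exact localExponent_eq_two_iff.2 (hπ.colon_sq_le p)

omit hπ in
lemma localExponent_pow_of_ne {p q : PrimeSpectrum S} (hpq : p ≠ q) (k : ℕ) :
    localExponent π (p.asIdeal ^ k) q = 0 :=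
  localExponent_eq_zero_iff.2 fun hle => hpq <| PrimeSpectrum.ext <|
    (Ideal.isMaximal_of_isPrime p.asIdeal).eq_of_le q.isPrime.ne_top (q.isPrime.le_of_pow_le hle)

lemma localExponent_surjective : Function.Surjective (localExponent π) := by
  classical
  intro t
  have := Fintype.ofFinite (PrimeSpectrum S)
  refine ⟨Finset.univ.inf fun p => p.asIdeal ^ (t p : ℕ), funext fun q => ?_⟩
  rw [localExponent_finset_inf]
  refine le_antisymm (Finset.sup_le fun p _ => ?_) ?_
  · by_cases hpq : p = q
    · rw [hpq, hπ.localExponent_pow_self]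
    · rw [localExponent_pow_of_ne hpq]
      exact Fin.zero_le _
  · rw [← hπ.localExponent_pow_self q (t q)]
    exact Finset.le_sup (f := fun p => localExponent π (p.asIdeal ^ (t p : ℕ)) q)
      (Finset.mem_univ q)

end IsSquareZeroUniformizer
end LocalExponent

section Hull

variable {S : Type*} [CommRing S] {π : S}

/-- The ideal `I ∩ σ⁻¹(Ann I)`. When `S` is the group algebra of a cyclic group and `σ` inverts the
group elements, this is the hull of the cyclic code `I`. -/
def idealHull (σ : S ≃+* S) (I : Ideal S) : Ideal S :=
  I ⊓ I.annihilator.comap σ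

/-- The length of the local component of `idealHull σ I` at a prime `p`, if `I` has local exponents
`a` at `p` and `b` at the conjugate prime `σ p`. -/
noncomputable def hullLength (a b : Fin 3) : ℝ :=
  (max a b.rev).rev.val

lemma expect_hullLength : 𝔼 a, 𝔼 b, hullLength a b = 5 / 9 := by
  simp only [Fintype.expect_eq_sum_div_card, Fin.sum_univ_three, hullLength, Fintype.card_fin]
  norm_num [Fin.rev]

lemma expect_hullLength_self : 𝔼 a, hullLength a a = 1 / 3 := by
  simp only [Fintype.expect_eq_sum_div_card, Fin.sum_univ_three, hullLength, Fintype.card_fin]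
  norm_num [Fin.rev]

namespace IsSquareZeroUniformizer

variable [Finite S] (hπ : IsSquareZeroUniformizer π) {σ : S ≃+* S} (hσ : σ π = π)
include hπ hσ

lemma log_card_idealHull [Fintype (PrimeSpectrum S)] (I : Ideal S) :
    Real.log (Nat.card (idealHull σ I)) = ∑ p : PrimeSpectrum S,
      hullLength (localExponent π I p)
        (localExponent π I (PrimeSpectrum.comap (σ.symm : S →+* S) p)) * logNorm p.asIdeal := by
  rw [hπ.log_card_ideal]
  refine Finset.sum_congr rfl fun p _ => ?_
  rw [idealHull, localExponent_inf, localExponent_comap σ hσ, hπ.localExponent_annihilator,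
    hullLength]

theorem expect_log_card_idealHull_lt [Fintype (Ideal S)] {p₀ : PrimeSpectrum S}
    (hp₀ : PrimeSpectrum.comap (σ.symm : S →+* S) p₀ = p₀) :
    𝔼 I : Ideal S, Real.log (Nat.card (idealHull σ I)) < 5 / 18 * Real.log (Nat.card S) := by
  classical
  have := Fintype.ofFinite (PrimeSpectrum S)
  let τ (p : PrimeSpectrum S) : PrimeSpectrum S := PrimeSpectrum.comap (σ.symm : S →+* S) p
  let w (p : PrimeSpectrum S) : ℝ := 𝔼 t : PrimeSpectrum S → Fin 3, hullLength (t p) (t (τ p))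
  have hw_fixed {p : PrimeSpectrum S} (hp : τ p = p) : w p = 1 / 3 := by
    simp only [w, hp]
    rw [expect_eval (fun a => hullLength a a) p, expect_hullLength_self]
  have hw_moved {p : PrimeSpectrum S} (hp : τ p ≠ p) : w p = 5 / 9 := by
    rw [← expect_hullLength]
    exact expect_eval_eval hullLength hp.symm
  have hw_le (p : PrimeSpectrum S) : w p ≤ 5 / 9 := by
    by_cases hp : τ p = p
    · rw [hw_fixed hp]; norm_num
    · exact (hw_moved hp).le
  have hpos (p : PrimeSpectrum S) : 0 < logNorm p.asIdeal := logNorm_pos p.isPrime.ne_top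
  calc 𝔼 I : Ideal S, Real.log (Nat.card (idealHull σ I))
    _ = 𝔼 t : PrimeSpectrum S → Fin 3, ∑ p, hullLength (t p) (t (τ p)) * logNorm p.asIdeal :=
        Fintype.expect_bijective _ ⟨hπ.localExponent_injective, hπ.localExponent_surjective⟩ _ _
          fun I => hπ.log_card_idealHull hσ I
    _ = ∑ p, w p * logNorm p.asIdeal := by
        rw [Finset.expect_sum_comm]
        exact Finset.sum_congr rfl fun p _ => (Finset.expect_mul _ _ _).symm
    _ < ∑ p : PrimeSpectrum S, 5 / 9 * logNorm p.asIdeal := by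
        refine Finset.sum_lt_sum
          (fun p _ => mul_le_mul_of_nonneg_right (hw_le p) (hpos p).le)
          ⟨p₀, Finset.mem_univ p₀, mul_lt_mul_of_pos_right ?_ (hpos p₀)⟩
        rw [hw_fixed hp₀]
        norm_num
    _ = 5 / 18 * Real.log (Nat.card S) := by
        rw [hπ.log_card_eq_two_mul_sum, ← Finset.mul_sum]
        ring

end IsSquareZeroUniformizer
end Hull

section GroupAlgebra

open AddMonoidAlgebra (single)

variable {A G : Type*} [CommRing A] [AddCommGroup G]

variable (A G) in
/-- The involution of the group algebra that inverts the group elements. -/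
noncomputable def inversion : AddMonoidAlgebra A G ≃+* AddMonoidAlgebra A G :=
  (AddMonoidAlgebra.domCongr A A (AddEquiv.neg G)).toRingEquiv

lemma inversion_algebraMap (a : A) :
    inversion A G (algebraMap A (AddMonoidAlgebra A G) a) = algebraMap A (AddMonoidAlgebra A G) a :=
  (AddMonoidAlgebra.domCongr A A (AddEquiv.neg G)).commutes a

lemma exists_comap_inversion_symm_eq_self [Nontrivial A] :
    ∃ p : PrimeSpectrum (AddMonoidAlgebra A G),
      PrimeSpectrum.comap ((inversion A G).symm : _ →+* _) p = p := by
  obtain ⟨q⟩ : Nonempty (PrimeSpectrum A) := inferInstance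
  let ε : AddMonoidAlgebra A G →+* A := (AddMonoidAlgebra.lift A A G 1).toRingHom
  have hε : ε.comp ((inversion A G).symm : _ →+* _) = ε := by
    ext x
    · simp [ε, inversion]
    · simp [ε, inversion]
  refine ⟨PrimeSpectrum.comap ε q, ?_⟩
  rw [← PrimeSpectrum.comap_comp_apply, hε]

lemma coeff_inversion_mul [Fintype G] (x y : AddMonoidAlgebra A G) (g : G) :
    (inversion A G x * y).coeff g = ∑ h, x.coeff h * y.coeff (h + g) := by
  rw [AddMonoidAlgebra.coeff_mul_apply_left, Finsupp.sum_fintype _ _ fun _ => zero_mul _,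
    ← Equiv.sum_comp (Equiv.neg G)]
  refine Finset.sum_congr rfl fun h _ => ?_
  have hcoeff : (inversion A G x).coeff (-h) = x.coeff h :=
    (AddMonoidAlgebra.coeff_domCongr (R := A) (AddEquiv.neg G) x (-h)).trans
      (congrArg x.coeff (neg_neg h))
  rw [Equiv.neg_apply, hcoeff, neg_neg]

/-- Translating `y` shows that orthogonality to an ideal already kills all coefficients. -/
lemma inversion_mem_annihilator_iff [Fintype G] (I : Ideal (AddMonoidAlgebra A G))
    (x : AddMonoidAlgebra A G) :
    inversion A G x ∈ I.annihilator ↔ ∀ y ∈ I, ∑ g, x.coeff g * y.coeff g = 0 := by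
  rw [Submodule.mem_annihilator]
  constructor
  · intro h y hy
    simpa [coeff_inversion_mul] using congrArg (fun z => z.coeff 0) (h y hy)
  · intro h y hy
    ext g
    have := h _ (I.mul_mem_left (single (-g) 1) hy)
    rw [smul_eq_mul, coeff_inversion_mul]
    simpa [add_comm] using this

variable [Finite G]

instance finite_addMonoidAlgebra [Finite A] : Finite (AddMonoidAlgebra A G) :=
  Module.finite_of_finite A

lemma algebraMap_dvd_iff {a : A} {x : AddMonoidAlgebra A G} :
    algebraMap A (AddMonoidAlgebra A G) a ∣ x ↔ ∀ g, a ∣ x.coeff g := by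
  constructor
  · rintro ⟨y, rfl⟩ g
    rw [← Algebra.smul_def]
    exact ⟨y.coeff g, rfl⟩
  · intro h
    choose c hc using h
    refine ⟨AddMonoidAlgebra.ofCoeff (Finsupp.equivFunOnFinite.symm c), ?_⟩
    ext g
    rw [← Algebra.smul_def]
    exact hc g

lemma trace_addMonoidAlgebra (x : AddMonoidAlgebra A G) :
    Algebra.trace A (AddMonoidAlgebra A G) x = Nat.card G * x.coeff 0 := by
  classical
  have := Fintype.ofFinite G
  have hdiag (g : G) : Algebra.leftMulMatrix (AddMonoidAlgebra.basis G A) x g g = x.coeff 0 := by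
    rw [Algebra.leftMulMatrix_eq_repr_mul, AddMonoidAlgebra.basis_apply]
    change (x * single g 1).coeff g = x.coeff 0
    rw [AddMonoidAlgebra.coeff_mul_single_apply, add_neg_cancel, mul_one]
  simp [Algebra.trace_eq_matrix_trace (AddMonoidAlgebra.basis G A), Matrix.trace, hdiag]

lemma isNilpotent_coeff (hG : IsUnit (Nat.card G : A)) {x : AddMonoidAlgebra A G}
    (hx : IsNilpotent x) (g : G) : IsNilpotent (x.coeff g) := by
  have htrace : IsNilpotent (Algebra.trace A (AddMonoidAlgebra A G) (single (-g) 1 * x)) :=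
    Algebra.isNilpotent_trace_of_isNilpotent ((Commute.all _ _).isNilpotent_mul_left hx)
  rw [trace_addMonoidAlgebra, AddMonoidAlgebra.coeff_single_mul_apply, one_mul, neg_neg,
    add_zero] at htrace
  obtain ⟨k, hk⟩ := htrace
  refine ⟨k, ?_⟩
  rw [mul_pow] at hk
  exact (hG.pow k).mul_right_eq_zero.1 hk

lemma IsSquareZeroUniformizer.addMonoidAlgebra {π : A} (hπ : IsSquareZeroUniformizer π)
    (hG : IsUnit (Nat.card G : A)) :
    IsSquareZeroUniformizer (algebraMap A (AddMonoidAlgebra A G) π) where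
  mul_eq_zero_iff x := by
    rw [algebraMap_dvd_iff, ← Algebra.smul_def, ← AddMonoidAlgebra.coeff_inj,
      DFunLike.ext_iff]
    exact forall_congr' fun g => hπ.mul_eq_zero_iff (x.coeff g)
  dvd_of_isNilpotent x hx :=
    algebraMap_dvd_iff.2 fun g => hπ.dvd_of_isNilpotent _ (isNilpotent_coeff hG hx g)

end GroupAlgebra

section CyclicCodes

open AddMonoidAlgebra (single)

variable {A : Type} [CommRing A] {n : ℕ}

variable (A n) in
/-- The usual identification of `∑ cᵢ xⁱ` in the group algebra of the cyclic group of order `n`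
with the word `(c₀, …, cₙ₋₁)`. -/
noncomputable def wordEquiv : AddMonoidAlgebra A (Fin n) ≃ₗ[A] (Fin n → A) :=
  (AddMonoidAlgebra.coeffLinearEquiv A).trans (Finsupp.linearEquivFunOnFinite A A (Fin n))

lemma wordEquiv_apply (x : AddMonoidAlgebra A (Fin n)) (i : Fin n) :
    wordEquiv A n x i = x.coeff i := rfl

variable [NeZero n]

lemma finRotate_symm_apply_eq_sub_one (i : Fin n) : (finRotate n).symm i = i - 1 := by
  rw [Equiv.symm_apply_eq, finRotate_apply, sub_add_cancel]

lemma wordEquiv_single_mul (g : Fin n) (a : A) (x : AddMonoidAlgebra A (Fin n)) :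
    wordEquiv A n (single g a * x) = a • fun i => wordEquiv A n x (i - g) := by
  ext i
  rw [wordEquiv_apply, AddMonoidAlgebra.coeff_single_mul_apply, neg_add_eq_sub]
  rfl

lemma IsCyclicCode.shift_mem {C : Submodule A (Fin n → A)} (hC : IsCyclicCode C)
    {c : Fin n → A} (hc : c ∈ C) (g : Fin n) : (fun i => c (i - g)) ∈ C := by
  obtain ⟨k, rfl⟩ := Nat.exists_eq_succ_of_ne_zero (NeZero.ne n)
  induction g using Fin.induction with
  | zero => simpa using hc
  | succ g ih =>
    convert hC _ ih using 3 with i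
    rw [finRotate_symm_apply_eq_sub_one, ← Fin.coeSucc_eq_succ]
    abel

/-- The ideal of the group algebra corresponding to a cyclic code. -/
noncomputable def IsCyclicCode.toIdeal {C : Submodule A (Fin n → A)} (hC : IsCyclicCode C) :
    Ideal (AddMonoidAlgebra A (Fin n)) where
  __ := (C.comap (wordEquiv A n).toLinearMap).toAddSubmonoid
  smul_mem' s x hx := by
    change wordEquiv A n (s * x) ∈ C
    induction s using AddMonoidAlgebra.induction_linear with
    | zero => simp
    | add s t hs ht =>
      rw [add_mul, map_add]
      exact C.add_mem hs ht
    | single g a =>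
      rw [wordEquiv_single_mul]
      exact C.smul_mem a (hC.shift_mem hx g)

lemma IsCyclicCode.mem_toIdeal {C : Submodule A (Fin n → A)} (hC : IsCyclicCode C)
    {x : AddMonoidAlgebra A (Fin n)} : x ∈ hC.toIdeal ↔ wordEquiv A n x ∈ C := Iff.rfl

/-- The cyclic code corresponding to an ideal of the group algebra. -/
noncomputable def codeOfIdeal (I : Ideal (AddMonoidAlgebra A (Fin n))) :
    Submodule A (Fin n → A) :=
  (I.restrictScalars A).comap (wordEquiv A n).symm.toLinearMap

lemma mem_codeOfIdeal {I : Ideal (AddMonoidAlgebra A (Fin n))} {c : Fin n → A} :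
    c ∈ codeOfIdeal I ↔ (wordEquiv A n).symm c ∈ I := Iff.rfl

lemma isCyclicCode_codeOfIdeal (I : Ideal (AddMonoidAlgebra A (Fin n))) :
    IsCyclicCode (codeOfIdeal I) := by
  intro c hc
  have hshift : (wordEquiv A n).symm (fun i => c ((finRotate n).symm i)) =
      single 1 1 * (wordEquiv A n).symm c := by
    rw [LinearEquiv.symm_apply_eq, wordEquiv_single_mul, one_smul, LinearEquiv.apply_symm_apply]
    simp only [finRotate_symm_apply_eq_sub_one]
  rw [mem_codeOfIdeal, hshift]
  exact I.mul_mem_left _ hc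

variable (A n) in
/-- Cyclic codes are the ideals of the group algebra of the cyclic group. -/
noncomputable def cyclicCodeEquiv :
    {C : Submodule A (Fin n → A) // IsCyclicCode C} ≃ Ideal (AddMonoidAlgebra A (Fin n)) where
  toFun C := C.2.toIdeal
  invFun I := ⟨codeOfIdeal I, isCyclicCode_codeOfIdeal I⟩
  left_inv C := by
    refine Subtype.ext (SetLike.ext fun c => ?_)
    rw [mem_codeOfIdeal, IsCyclicCode.mem_toIdeal, LinearEquiv.apply_symm_apply]
  right_inv I := by
    ext x
    rw [IsCyclicCode.mem_toIdeal, mem_codeOfIdeal, LinearEquiv.symm_apply_apply]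

lemma IsCyclicCode.mem_dualCode_iff {C : Submodule A (Fin n → A)} (hC : IsCyclicCode C)
    (x : AddMonoidAlgebra A (Fin n)) :
    wordEquiv A n x ∈ dualCode C ↔ inversion A (Fin n) x ∈ hC.toIdeal.annihilator := by
  rw [inversion_mem_annihilator_iff]
  exact (wordEquiv A n).surjective.forall

lemma IsCyclicCode.card_hull {C : Submodule A (Fin n → A)} (hC : IsCyclicCode C) :
    Nat.card (hull C) = Nat.card (idealHull (inversion A (Fin n)) hC.toIdeal) :=
  Nat.card_congr <| ((wordEquiv A n).toEquiv.subtypeEquiv fun x =>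
    and_congr Iff.rfl (hC.mem_dualCode_iff x).symm).symm

end CyclicCodes

section Z4v

open Polynomial

lemma IsSquareZeroUniformizer.map_ringEquiv {S T : Type*} [CommRing S] [CommRing T] {π : S}
    (hπ : IsSquareZeroUniformizer π) (e : S ≃+* T) : IsSquareZeroUniformizer (e π) where
  mul_eq_zero_iff := e.surjective.forall.2 fun x => by
    rw [← map_mul, map_eq_zero_iff e e.injective, hπ.mul_eq_zero_iff, map_dvd_iff]
  dvd_of_isNilpotent := e.surjective.forall.2 fun x hx =>
    map_dvd e (hπ.dvd_of_isNilpotent x ((IsNilpotent.map_iff e.injective).1 hx))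

lemma IsSquareZeroUniformizer.prodMk {S T : Type*} [CommRing S] [CommRing T] {π : S} {ρ : T}
    (hπ : IsSquareZeroUniformizer π) (hρ : IsSquareZeroUniformizer ρ) :
    IsSquareZeroUniformizer (π, ρ) where
  mul_eq_zero_iff x := by
    rw [Prod.ext_iff, prod_dvd_iff]
    exact and_congr (hπ.mul_eq_zero_iff x.1) (hρ.mul_eq_zero_iff x.2)
  dvd_of_isNilpotent x hx := prod_dvd_iff.2
    ⟨hπ.dvd_of_isNilpotent _ (hx.map (RingHom.fst S T)),
      hρ.dvd_of_isNilpotent _ (hx.map (RingHom.snd S T))⟩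

lemma isSquareZeroUniformizer_two_zmod_four : IsSquareZeroUniformizer (2 : ZMod 4) where
  mul_eq_zero_iff := by decide
  dvd_of_isNilpotent x := by
    rintro ⟨k, hk⟩
    have hdvd_or_inv : ∀ x : ZMod 4, 2 ∣ x ∨ x * x = 1 := by decide
    refine (hdvd_or_inv x).resolve_right fun hx => ?_
    have hone : (0 : ZMod 4) = 1 := by
      rw [← one_pow k, ← hx, mul_pow, hk, zero_mul]
    exact absurd hone (by decide)

/-- Evaluation of `v` at the two roots `0` and `1` of `v² - v`. -/
noncomputable def adjoinIdempotentEquiv (R : Type*) [CommRing R] :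
    AdjoinRoot (X ^ 2 - X : R[X]) ≃+* R × R :=
  have hfactor : Ideal.span {(X ^ 2 - X : R[X])} =
      Ideal.span {X - C (0 : R)} * Ideal.span {X - C (1 : R)} := by
    rw [Ideal.span_singleton_mul_span_singleton, C_0, C_1]
    ring_nf
  have hcoprime : IsCoprime (Ideal.span {X - C (0 : R)}) (Ideal.span {X - C (1 : R)}) :=
    (Ideal.isCoprime_span_singleton_iff _ _).2 ⟨1, -1, by rw [C_0, C_1]; ring⟩
  (Ideal.quotEquivOfEq hfactor).trans <|
    (Ideal.quotientMulEquivQuotientProd _ _ hcoprime).trans <|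
      RingEquiv.prodCongr (quotientSpanXSubCAlgEquiv 0).toRingEquiv
        (quotientSpanXSubCAlgEquiv 1).toRingEquiv

lemma isSquareZeroUniformizer_two_Z4v : IsSquareZeroUniformizer (2 : Z4v) := by
  have h := (isSquareZeroUniformizer_two_zmod_four.prodMk
    isSquareZeroUniformizer_two_zmod_four).map_ringEquiv (adjoinIdempotentEquiv (ZMod 4)).symm
  have : ((2, 2) : ZMod 4 × ZMod 4) = 2 := rfl
  rwa [this, map_ofNat] at h

lemma card_Z4v : Nat.card Z4v = 16 := by
  rw [Nat.card_congr (adjoinIdempotentEquiv (ZMod 4)).toEquiv, Nat.card_prod, Nat.card_zmod]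

instance nontrivial_Z4v : Nontrivial Z4v :=
  Finite.one_lt_card_iff_nontrivial.1 (by rw [card_Z4v]; norm_num)

lemma isUnit_natCast_Z4v {n : ℕ} (hn : Odd n) : IsUnit (n : Z4v) := by
  have h : IsUnit (n : ZMod 4) :=
    (ZMod.isUnit_iff_coprime n 4).2 (hn.coprime_two_right.pow_right 2)
  simpa using h.map (algebraMap (ZMod 4) Z4v)

end Z4v

end CyclicHull

open CyclicHull in
theorem corollary5p3_general {A : Type} [CommRing A] [Finite A] [Nontrivial A] {π : A}
    (hπ : IsSquareZeroUniformizer π) {n : ℕ} (hn : IsUnit (n : A))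
    [Fintype {C : Submodule A (Fin n → A) // IsCyclicCode C}] :
    (∑ C : {C : Submodule A (Fin n → A) // IsCyclicCode C}, twoDim (hull C.1)) /
        Fintype.card {C : Submodule A (Fin n → A) // IsCyclicCode C} <
      5 / 18 * (n * Real.logb 2 (Nat.card A)) := by
  have : NeZero n := ⟨fun h => hn.ne_zero (by rw [h, Nat.cast_zero])⟩
  have := Fintype.ofFinite (Ideal (AddMonoidAlgebra A (Fin n)))
  have hS := hπ.addMonoidAlgebra (G := Fin n) (by rwa [Nat.card_fin])
  obtain ⟨p₀, hp₀⟩ := exists_comap_inversion_symm_eq_self (A := A) (G := Fin n)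
  have hcard : Real.log (Nat.card (AddMonoidAlgebra A (Fin n))) = n * Real.log (Nat.card A) := by
    rw [Nat.card_congr (wordEquiv A n).toEquiv, Nat.card_fun, Nat.card_fin, Nat.cast_pow,
      Real.log_pow]
  have hsum : ∑ C : {C : Submodule A (Fin n → A) // IsCyclicCode C}, twoDim (hull C.1) =
      (∑ I, Real.log (Nat.card (idealHull (inversion A (Fin n)) I))) / Real.log 2 := by
    rw [Finset.sum_div]
    exact Fintype.sum_equiv (cyclicCodeEquiv A n) _ _ fun C =>
      congrArg (fun k : ℕ => Real.logb 2 k) C.2.card_hull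
  have hlt := hS.expect_log_card_idealHull_lt (inversion_algebraMap π) hp₀
  rw [hcard, Fintype.expect_eq_sum_div_card, ← Fintype.card_congr (cyclicCodeEquiv A n)] at hlt
  rw [hsum, div_right_comm, Real.logb, ← mul_div_assoc, ← mul_div_assoc]
  exact div_lt_div_of_pos_right hlt (Real.log_pos one_lt_two)

theorem corollary5p3 (n : ℕ) (hn : Odd n) :
    CyclicHull.averageHullDim n < 10 * (n : ℝ) / 9 := by
  have hlogb : Real.logb 2 (Nat.card CyclicHull.Z4v) = 4 := by
    rw [CyclicHull.card_Z4v, show ((16 : ℕ) : ℝ) = 2 ^ 4 by norm_num, Real.logb_pow]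
    norm_num
  let _ : Fintype {C : Submodule CyclicHull.Z4v (Fin n → CyclicHull.Z4v) //
    CyclicHull.IsCyclicCode C} := CyclicHull.fintype_cyclicCode n
  calc CyclicHull.averageHullDim n
    _ < 5 / 18 * (n * Real.logb 2 (Nat.card CyclicHull.Z4v)) :=
        corollary5p3_general CyclicHull.isSquareZeroUniformizer_two_Z4v
          (CyclicHull.isUnit_natCast_Z4v hn)
    _ = 10 * n / 9 := by rw [hlogb]; ring
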